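/- Let $m\ge 0$ and $N\ge 1$ be integers, $\varepsilon_1,\varepsilon_2\in(0,1)$, and let $p_1,p_2,\dots$ be a sequence of points of $\mathbb R^m$ with the Euclidean distance $d$. A ball is $B(c,r)=\{q\in\mathbb R^m: d(c,q)\le r\}$, its $\mu$-expansion is $\mu\cdot B(c,r)=B(c,\mu r)$, and $\mathsf{MEB}(P)$ is the minimum enclosing ball of a nonempty finite set $P$. The sliding window at time $t\ge 1$ is $W_t=\{p_{t'},\dots,p_t\}$ with $t'=\max(1,t-N+1)$. AOMEB. For $x\le t$ let $S[x,x]=\{p_x\}$, and for $t>x$ let $S[x,t]=S[x,t-1]$ if $p_t\in(1+\varepsilon_1)\cdot\mathsf{MEB}(S[x,t-1])$ and $S[x,t]=S[x,t-1]\cup\{p_t\}$ otherwise. Let $r[x,t]$ be the radius of $\mathsf{MEB}(S[x,t])$. SWMEB+. It keeps a sequence $X_t$ of indices $x_1,\dots,x_s$ (renumbered after every change), with $X_0$ empty. At each time $t=1,2,\dots$ it does the following, starting from $X_{t-1}$: (1) append the index $t$; (2) while there is a second index and $x_2<t-N+1$, delete $x_1$; (3) update every instance with $p_t$, so that the coresets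 are $S[x_i,t]$; (4) while there is an $i$ with $1\le i\le s-2$ and $r[x_i,t]\le(1+\varepsilon_2)\,r[x_{i+2},t]$, delete $x_{i+1}$ for some such $i$. The result is $X_t$, and the coreset returned at time $t$ is $S_t=S[x_1,t]$ if $x_1\ge t-N+1$, and $S_t=S[x_2,t]$ otherwise. Theorem. There is an absolute constant $C>0$ such that for all $m,N,\varepsilon_1,\varepsilon_2$ and all sequences as above, whatever choices of $i$ are made in step (4), for every $t\ge 1$ and every $q\in W_t$, $$q\in\bigl(4\sqrt2+4+\varepsilon\bigr)\cdot\mathsf{MEB}(S_t),\qquad \varepsilon=C\bigl(\sqrt{\varepsilon_1}+\sqrt{\varepsilon_2}\bigr),$$ where $4\sqrt2+4\approx 9.66$. -/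

import Mathlib

namespace SlidingMEB

/-- Points of `ℝᵐ`, with the Euclidean distance. -/
abbrev Pt (m : ℕ) : Type := EuclideanSpace ℝ (Fin m)

/-- A closed ball, given by its center and its radius. -/
structure Ball (m : ℕ) where
  center : Pt m
  radius : ℝ

/-- The set of points of the ball `B(c, r) = {p : d(c, p) ≤ r}`. -/
def Ball.points {m : ℕ} (B : Ball m) : Set (Pt m) := {p | dist B.center p ≤ B.radius}

/-- The `μ`-expansion `μ · B`: same center, radius multiplied by `μ`. -/
def Ball.expand {m : ℕ} (μ : ℝ) (B : Ball m) : Ball m := ⟨B.center, μ * B.radius⟩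

/-- `B` is a smallest ball that contains all points of `P`. -/
def IsMEB {m : ℕ} (P : Finset (Pt m)) (B : Ball m) : Prop :=
  (∀ p ∈ P, p ∈ B.points) ∧ ∀ B' : Ball m, (∀ p ∈ P, p ∈ B'.points) → B.radius ≤ B'.radius

theorem exists_isMEB {m : ℕ} (P : Finset (Pt m)) (hP : P.Nonempty) : ∃ B : Ball m, IsMEB P B := by
  obtain ⟨q, hq⟩ := hP
  let f : Pt m → ℝ := fun c => P.sup' ⟨q, hq⟩ (fun p => dist c p)
  have hf : Continuous f := by
    apply Continuous.finset_sup'_apply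
    intro p _
    fun_prop
  have hlim : Filter.Tendsto f (Filter.cocompact (Pt m)) Filter.atTop := by
    refine Filter.tendsto_atTop_mono ?_ (tendsto_dist_right_cocompact_atTop q)
    intro c
    exact Finset.le_sup' (fun p => dist c p) hq
  obtain ⟨c, hc⟩ := hf.exists_forall_le hlim
  refine ⟨⟨c, f c⟩, fun p hp => Finset.le_sup' (fun p => dist c p) hp, fun B' hB' => ?_⟩
  exact (hc B'.center).trans (Finset.sup'_le _ _ hB')

theorem IsMEB.unique {m : ℕ} {P : Finset (Pt m)} (hP : P.Nonempty) {B B' : Ball m}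
    (h : IsMEB P B) (h' : IsMEB P B') : B = B' := by
  obtain ⟨c, r⟩ := B
  obtain ⟨c', r'⟩ := B'
  obtain rfl : r = r' := le_antisymm (h.2 _ h'.1) (h'.2 _ h.1)
  obtain ⟨q, hq⟩ := hP
  have key : ∀ p ∈ P, dist ((1 / 2 : ℝ) • (c + c')) p ^ 2 ≤ r ^ 2 - dist c c' ^ 2 / 4 := by
    intro p hp
    have h1 : dist c p ≤ r := h.1 p hp
    have h2 : dist c' p ≤ r := h'.1 p hp
    have e := parallelogram_law_with_norm ℝ (c - p) (c' - p)
    have e1 : c - p + (c' - p) = (2 : ℝ) • ((1 / 2 : ℝ) • (c + c') - p) := by module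
    have e2 : c - p - (c' - p) = c - c' := by abel
    rw [e1, e2, norm_smul] at e
    simp only [← dist_eq_norm] at e
    norm_num at e
    norm_num
    have h3 := pow_le_pow_left₀ dist_nonneg h1 2
    have h4 := pow_le_pow_left₀ dist_nonneg h2 2
    nlinarith
  have h0 : 0 ≤ r := dist_nonneg.trans (h.1 q hq)
  have hs : 0 ≤ r ^ 2 - dist c c' ^ 2 / 4 := (sq_nonneg _).trans (key q hq)
  have hle : r ≤ Real.sqrt (r ^ 2 - dist c c' ^ 2 / 4) :=
    h.2 ⟨(1 / 2 : ℝ) • (c + c'), _⟩ fun p hp => Real.le_sqrt_of_sq_le (key p hp)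
  have hsq := (Real.le_sqrt h0 hs).1 hle
  have hd : dist c c' = 0 := by
    have := sq_nonneg (dist c c')
    exact pow_eq_zero_iff two_ne_zero |>.1 (by linarith)
  rw [dist_eq_zero.1 hd]

open Classical in
/-- The minimum enclosing ball of a nonempty finite point set (arbitrary for the empty set). -/
noncomputable def MEB {m : ℕ} (P : Finset (Pt m)) : Ball m :=
  if hP : P.Nonempty then (exists_isMEB P hP).choose else ⟨0, 0⟩

theorem isMEB_MEB {m : ℕ} (P : Finset (Pt m)) (hP : P.Nonempty) : IsMEB P (MEB P) := by
  unfold MEB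
  rw [dif_pos hP]
  exact (exists_isMEB P hP).choose_spec

theorem MEB_singleton {m : ℕ} (p : Pt m) : MEB {p} = ⟨p, 0⟩ := by
  refine (isMEB_MEB {p} (Finset.singleton_nonempty p)).unique (Finset.singleton_nonempty p) ⟨?_, ?_⟩
  · intro q hq
    rw [Finset.mem_singleton.1 hq]
    exact (dist_self p).le
  · intro B' hB'
    exact dist_nonneg.trans (hB' p (Finset.mem_singleton_self p))

open Classical in
/-- One update of AOMEB with a new point `p`: the point joins the coreset `S` exactly when it lies
outside of the `(1 + ε₁)`-expansion of the current ball `MEB(S)`. -/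
noncomputable def aomebStep {m : ℕ} (ε₁ : ℝ) (S : Finset (Pt m)) (p : Pt m) : Finset (Pt m) :=
  if p ∈ ((MEB S).expand (1 + ε₁)).points then S else insert p S

/-- The coreset returned by AOMEB on a finite sequence of points. It starts with the first point
(whose minimum enclosing ball is the ball of radius `0` around it) and then makes one pass. -/
noncomputable def aomeb {m : ℕ} (ε₁ : ℝ) : List (Pt m) → Finset (Pt m)
  | [] => ∅
  | p :: l => l.foldl (aomebStep ε₁) {p}

/-- The substream `⟨p x, …, p t⟩`. -/
def substream {m : ℕ} (p : ℕ → Pt m) (x t : ℕ) : List (Pt m) :=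
  (List.range' x (t + 1 - x)).map p

/-- `S[x,t]`: the coreset of the AOMEB instance started at index `x`, after it has processed
the point `p t`. -/
noncomputable def coreset {m : ℕ} (ε₁ : ℝ) (p : ℕ → Pt m) (x t : ℕ) : Finset (Pt m) :=
  aomeb ε₁ (substream p x t)

/-- `r[x,t]`: the radius of `MEB(S[x,t])`. -/
noncomputable def coresetRadius {m : ℕ} (ε₁ : ℝ) (p : ℕ → Pt m) (x t : ℕ) : ℝ :=
  (MEB (coreset ε₁ p x t)).radius

open Classical in
/-- The sliding window `W_t`: the latest `N` points among `p 1, …, p t`. -/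
noncomputable def window {m : ℕ} (p : ℕ → Pt m) (N t : ℕ) : Finset (Pt m) :=
  (Finset.Icc (max 1 (t + 1 - N)) t).image p

/-- At time `t` the index `x` has expired: `x < t - N + 1` (as integers). -/
def Expired (N t x : ℕ) : Prop := x + N < t + 1

open Classical in
/-- As long as the second index has expired, delete the first one. -/
noncomputable def dropExpired (N t : ℕ) : List ℕ → List ℕ
  | [] => []
  | [x₁] => [x₁]
  | x₁ :: x₂ :: l => if Expired N t x₂ then dropExpired N t (x₂ :: l) else x₁ :: x₂ :: l

/-- One deletion in the pruning loop, with `r` the current radii: if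
`r xᵢ ≤ (1 + ε₂) r xᵢ₊₂` for three neighboring indices, then `xᵢ₊₁` may be deleted. -/
inductive PruneStep (ε₂ : ℝ) (r : ℕ → ℝ) : List ℕ → List ℕ → Prop
  | delete (l l' : List ℕ) (x y z : ℕ) (h : r x ≤ (1 + ε₂) * r z) :
      PruneStep ε₂ r (l ++ x :: y :: z :: l') (l ++ x :: z :: l')

/-- `Y` is a possible result of the pruning loop on `X`: it is reached by deletions, chosen in any
order, and no further deletion is possible. -/
def Prunes (ε₂ : ℝ) (r : ℕ → ℝ) (X Y : List ℕ) : Prop :=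
  Relation.ReflTransGen (PruneStep ε₂ r) X Y ∧ ∀ Z, ¬ PruneStep ε₂ r Y Z

/-- `X t` is the sequence of indices kept at the end of time `t` in a run of SWMEB+ on the stream
`p 1, p 2, …`: at each time `t + 1` the new index is appended, expired indices are dropped, all
instances process `p (t + 1)`, and the indices are pruned by means of the updated radii. -/
def IsRun {m : ℕ} (ε₁ ε₂ : ℝ) (N : ℕ) (p : ℕ → Pt m) (X : ℕ → List ℕ) : Prop :=
  X 0 = [] ∧ ∀ t : ℕ, Prunes ε₂ (fun x => coresetRadius ε₁ p x (t + 1))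
    (dropExpired N (t + 1) (X t ++ [t + 1])) (X (t + 1))

open Classical in
/-- The coreset returned at time `t` if `X` is the sequence of indices kept: `S[x₁,t]` if `x₁` has
not expired, and `S[x₂,t]` otherwise (the empty set if there is no such index). -/
noncomputable def returned {m : ℕ} (ε₁ : ℝ) (N : ℕ) (p : ℕ → Pt m) (t : ℕ) :
    List ℕ → Finset (Pt m)
  | [] => ∅
  | [x₁] => if Expired N t x₁ then ∅ else coreset ε₁ p x₁ t
  | x₁ :: x₂ :: _ => if Expired N t x₁ then coreset ε₁ p x₂ t else coreset ε₁ p x₁ t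

/-- The pruning loop always terminates. -/
theorem exists_prunes (ε₂ : ℝ) (r : ℕ → ℝ) (X : List ℕ) : ∃ Y, Prunes ε₂ r X Y := by
  induction hn : X.length using Nat.strong_induction_on generalizing X with
  | _ n ih =>
    by_cases h : ∃ Z, PruneStep ε₂ r X Z
    · obtain ⟨Z, hZ⟩ := h
      have hlt : Z.length < n := by
        subst hn
        cases hZ
        simp
      obtain ⟨Y, hY⟩ := ih _ hlt Z rfl
      exact ⟨Y, hY.1.head hZ, hY.2⟩
    · exact ⟨X, .refl, fun Z hZ => h ⟨Z, hZ⟩⟩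

/-- SWMEB+ has a run on every stream. -/
theorem exists_isRun {m : ℕ} (ε₁ ε₂ : ℝ) (N : ℕ) (p : ℕ → Pt m) :
    ∃ X : ℕ → List ℕ, IsRun ε₁ ε₂ N p X :=
  ⟨fun t => Nat.rec [] (fun t X => (exists_prunes ε₂ (fun x => coresetRadius ε₁ p x (t + 1))
    (dropExpired N (t + 1) (X ++ [t + 1]))).choose) t,
    rfl, fun _ => (exists_prunes _ _ _).choose_spec⟩

end SlidingMEB

/-! Everything rests on one inequality: if a ball with center `c'` and radius `r'` encloses `P`, and
`MEB P` has center `c` and radius `r`, then `r² + d(c,c')² ≤ r'²`. Applied to growing coresets, it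
shows that AOMEB covers every point it has seen with factor `√2(1+ε₁)`. A live first index must be
1, so its instance has seen the whole window. If the first index `x` has expired, the instance of
the second index `z` is used, and only window points strictly between `x` and `z` are in doubt. Then
`x`, `z` are not consecutive, so pruning at some time `s` found `r[x,s] ≤ (1+ε₂) r[z,s]`. The
triangle inequality through the centers of `S[z,s]` and `S[x,s]` gives the factor
`2√2(1+ε₁)(1+ε₂)+1`, well below the required one. -/

namespace SlidingMEB

/-! ### Geometry of minimum enclosing balls -/

section Balls

variable {m : ℕ}

theorem MEB_radius_nonneg (P : Finset (Pt m)) : 0 ≤ (MEB P).radius := by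
  by_cases hP : P.Nonempty
  · obtain ⟨q, hq⟩ := hP
    exact dist_nonneg.trans ((isMEB_MEB P ⟨q, hq⟩).1 q hq)
  · simp [MEB, hP]

theorem MEB_radius_mono {S T : Finset (Pt m)} (hS : S.Nonempty) (h : S ⊆ T) :
    (MEB S).radius ≤ (MEB T).radius :=
  (isMEB_MEB S hS).2 _ fun p hp => (isMEB_MEB T (hS.mono h)).1 p (h hp)

/-- Squared distance from a point of the segment between `c` and `c'`. -/
theorem dist_sq_lineMap (c c' p : Pt m) (a : ℝ) :
    dist ((1 - a) • c + a • c') p ^ 2 =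
      (1 - a) * dist c p ^ 2 + a * dist c' p ^ 2 - a * (1 - a) * dist c c' ^ 2 := by
  have e1 : (1 - a) • c + a • c' - p = (1 - a) • (c - p) + a • (c' - p) := by module
  have e2 : c - c' = (c - p) - (c' - p) := by abel
  rw [dist_eq_norm, dist_eq_norm, dist_eq_norm, dist_eq_norm, e1, e2, norm_add_sq_real,
    norm_sub_sq_real (c - p), norm_smul, norm_smul, real_inner_smul_left, real_inner_smul_right,
    mul_pow, mul_pow, Real.norm_eq_abs, Real.norm_eq_abs, sq_abs, sq_abs]
  ring

/-- A ball that encloses `P` has its center close to that of the minimum enclosing ball of `P`,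
relative to the difference of the squared radii. -/
theorem IsMEB.radius_sq_add_dist_sq_le {P : Finset (Pt m)} (hP : P.Nonempty) {B B' : Ball m}
    (h : IsMEB P B) (h' : ∀ p ∈ P, p ∈ B'.points) :
    B.radius ^ 2 + dist B.center B'.center ^ 2 ≤ B'.radius ^ 2 := by
  obtain ⟨c, r⟩ := B
  obtain ⟨c', r'⟩ := B'
  have h0 : 0 ≤ r := by
    obtain ⟨q, hq⟩ := hP
    exact dist_nonneg.trans (h.1 q hq)
  -- Move the center from `c` towards `c'` by a fraction `a`: minimality of `r` bounds the new
  -- squared radius below. Divide by `a`, then let `a → 0`.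
  have key : ∀ a ∈ Set.Ioo (0 : ℝ) 1, (1 - a) * dist c c' ^ 2 ≤ r' ^ 2 - r ^ 2 := by
    intro a ha
    have hb : ∀ p ∈ P, dist ((1 - a) • c + a • c') p ^ 2 ≤
        (1 - a) * r ^ 2 + a * r' ^ 2 - a * (1 - a) * dist c c' ^ 2 := by
      intro p hp
      have h1 : dist c p ^ 2 ≤ r ^ 2 := pow_le_pow_left₀ dist_nonneg (h.1 p hp) 2
      have h2 : dist c' p ^ 2 ≤ r' ^ 2 := pow_le_pow_left₀ dist_nonneg (h' p hp) 2
      rw [dist_sq_lineMap]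
      have h3 := mul_le_mul_of_nonneg_left h1 (sub_nonneg.2 ha.2.le)
      have h4 := mul_le_mul_of_nonneg_left h2 ha.1.le
      linarith
    have hle : r ≤ Real.sqrt ((1 - a) * r ^ 2 + a * r' ^ 2 - a * (1 - a) * dist c c' ^ 2) :=
      h.2 ⟨(1 - a) • c + a • c', _⟩ fun p hp => Real.le_sqrt_of_sq_le (hb p hp)
    obtain ⟨q, hq⟩ := hP
    have hsq := (Real.le_sqrt h0 ((sq_nonneg _).trans (hb q hq))).1 hle
    refine le_of_mul_le_mul_left ?_ ha.1
    linarith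
  have hlim : Filter.Tendsto (fun a : ℝ => (1 - a) * dist c c' ^ 2) (nhdsWithin 0 (Set.Ioi 0))
      (nhds (dist c c' ^ 2)) := by
    have hc : Continuous fun a : ℝ => (1 - a) * dist c c' ^ 2 := by fun_prop
    simpa using (hc.tendsto 0).mono_left nhdsWithin_le_nhds
  have := le_of_tendsto hlim (Filter.mem_of_superset (Ioo_mem_nhdsGT one_pos) key)
  change r ^ 2 + dist c c' ^ 2 ≤ r' ^ 2
  linarith

theorem MEB_dist_center_le {S : Finset (Pt m)} (hS : S.Nonempty) {B : Ball m} (hB : 0 ≤ B.radius)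
    (h : ∀ p ∈ S, p ∈ B.points) : dist (MEB S).center B.center ≤ B.radius := by
  have := (isMEB_MEB S hS).radius_sq_add_dist_sq_le hS h
  exact abs_le_of_sq_le_sq' (by nlinarith [sq_nonneg (MEB S).radius]) hB |>.2

/-- Passing from `S` to a superset costs at most a factor `√2` in the expansion of the ball. -/
theorem mem_expand_MEB_of_subset {S T : Finset (Pt m)} (hS : S.Nonempty) (h : S ⊆ T) {μ : ℝ}
    (hμ : 1 ≤ μ) {p : Pt m} (hp : p ∈ ((MEB S).expand μ).points) :
    p ∈ ((MEB T).expand (Real.sqrt 2 * μ)).points := by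
  have hT := isMEB_MEB T (hS.mono h)
  have hd := (isMEB_MEB S hS).radius_sq_add_dist_sq_le hS fun q hq => hT.1 q (h hq)
  have hp : dist (MEB S).center p ≤ μ * (MEB S).radius := hp
  change dist (MEB T).center p ≤ Real.sqrt 2 * μ * (MEB T).radius
  have h0 := MEB_radius_nonneg T
  -- The source of `√2`: `(r + d)² ≤ 2(r² + d²)`.
  have hsum : (MEB S).radius + dist (MEB S).center (MEB T).center ≤
      Real.sqrt 2 * (MEB T).radius := by
    refine (abs_le_of_sq_le_sq' ?_ (by positivity)).2
    rw [mul_pow, Real.sq_sqrt zero_le_two]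
    nlinarith [sq_nonneg ((MEB S).radius - dist (MEB S).center (MEB T).center)]
  have htri := dist_triangle_left (MEB T).center p (MEB S).center
  have hdμ : dist (MEB S).center (MEB T).center ≤ μ * dist (MEB S).center (MEB T).center :=
    le_mul_of_one_le_left dist_nonneg hμ
  have := mul_le_mul_of_nonneg_left hsum (zero_le_one.trans hμ)
  linarith

theorem mem_expand_mono {P : Finset (Pt m)} {μ ν : ℝ} (h : μ ≤ ν) {q : Pt m}
    (hq : q ∈ ((MEB P).expand μ).points) : q ∈ ((MEB P).expand ν).points :=
  le_trans hq (mul_le_mul_of_nonneg_right h (MEB_radius_nonneg P))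

end Balls

/-! ### Coverage by AOMEB coresets -/

section Coresets

variable {m : ℕ} {ε₁ : ℝ} {p : ℕ → Pt m}

theorem subset_aomebStep (S : Finset (Pt m)) (q : Pt m) : S ⊆ aomebStep ε₁ S q := by
  unfold aomebStep
  split_ifs
  · exact subset_rfl
  · exact Finset.subset_insert _ _

theorem mem_expand_MEB_of_mem {S : Finset (Pt m)} {q : Pt m} (hq : q ∈ S) (hε : 0 ≤ ε₁) :
    q ∈ ((MEB S).expand (1 + ε₁)).points := by
  have h : dist (MEB S).center q ≤ (MEB S).radius := (isMEB_MEB S ⟨q, hq⟩).1 q hq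
  refine h.trans ?_
  exact le_mul_of_one_le_left (MEB_radius_nonneg S) (by linarith)

theorem mem_expand_MEB_aomebStep (hε : 0 ≤ ε₁) (S : Finset (Pt m)) (q : Pt m) :
    q ∈ ((MEB (aomebStep ε₁ S q)).expand (1 + ε₁)).points := by
  unfold aomebStep
  split_ifs with h
  · exact h
  · exact mem_expand_MEB_of_mem (Finset.mem_insert_self _ _) hε

theorem coreset_self (x : ℕ) : coreset ε₁ p x x = {p x} := by
  simp [coreset, substream, aomeb]

theorem coreset_succ {x t : ℕ} (h : x ≤ t) :
    coreset ε₁ p x (t + 1) = aomebStep ε₁ (coreset ε₁ p x t) (p (t + 1)) := by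
  obtain ⟨k, rfl⟩ := Nat.exists_eq_add_of_le h
  have e1 : x + k + 1 + 1 - x = k + 1 + 1 := by omega
  have e2 : x + k + 1 - x = k + 1 := by omega
  simp only [coreset, substream, e1, e2]
  rw [List.range'_1_concat (n := k + 1), List.range'_succ]
  simp [aomeb, add_assoc]

theorem coreset_mono {x s t : ℕ} (hx : x ≤ s) (hst : s ≤ t) :
    coreset ε₁ p x s ⊆ coreset ε₁ p x t := by
  induction t, hst using Nat.le_induction with
  | base => exact subset_rfl
  | succ t hst ih =>
    rw [coreset_succ (hx.trans hst)]
    exact ih.trans (subset_aomebStep _ _)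

theorem coreset_nonempty {x t : ℕ} (h : x ≤ t) : (coreset ε₁ p x t).Nonempty := by
  refine Finset.Nonempty.mono (coreset_mono le_rfl h) ?_
  rw [coreset_self]
  exact Finset.singleton_nonempty _

theorem exists_of_mem_coreset {x t : ℕ} (h : x ≤ t) {q : Pt m} (hq : q ∈ coreset ε₁ p x t) :
    ∃ j, x ≤ j ∧ j ≤ t ∧ p j = q := by
  induction t, h using Nat.le_induction with
  | base =>
    rw [coreset_self, Finset.mem_singleton] at hq
    exact ⟨x, le_rfl, le_rfl, hq.symm⟩
  | succ t h ih =>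
    have hq' : q ∈ coreset ε₁ p x t ∨ q = p (t + 1) := by
      rw [coreset_succ h, aomebStep] at hq
      split_ifs at hq
      · exact .inl hq
      · exact (Finset.mem_insert.1 hq).symm
    rcases hq' with hq' | rfl
    · obtain ⟨j, h1, h2, h3⟩ := ih hq'
      exact ⟨j, h1, by omega, h3⟩
    · exact ⟨t + 1, by omega, le_rfl, rfl⟩

/-- AOMEB returns a `√2 (1 + ε₁)`-coreset. -/
theorem mem_expand_MEB_coreset (hε : 0 ≤ ε₁) {x j t : ℕ} (hx : x ≤ j) (hj : j ≤ t) :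
    p j ∈ ((MEB (coreset ε₁ p x t)).expand (Real.sqrt 2 * (1 + ε₁))).points := by
  refine mem_expand_MEB_of_subset (coreset_nonempty hx) (coreset_mono hx hj) (by linarith) ?_
  obtain rfl | hlt := hx.eq_or_lt
  · exact mem_expand_MEB_of_mem (by simp [coreset_self]) hε
  · obtain ⟨j, rfl⟩ := Nat.exists_eq_add_one_of_ne_zero (Nat.ne_zero_of_lt hlt)
    rw [coreset_succ (by omega)]
    exact mem_expand_MEB_aomebStep hε _ _

/-- If the radii of two instances were close at some time `s`, then the later instance also covers
the points that only the earlier one has seen. -/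
theorem mem_expand_MEB_coreset_of_radius_le {ε₂ : ℝ} (hε : 0 ≤ ε₁) (hε₂ : 0 ≤ ε₂)
    {x z j s t : ℕ} (hxj : x ≤ j) (hjz : j ≤ z) (hzs : z ≤ s) (hst : s ≤ t)
    (hr : coresetRadius ε₁ p x s ≤ (1 + ε₂) * coresetRadius ε₁ p z s) :
    p j ∈ ((MEB (coreset ε₁ p z t)).expand
      (2 * Real.sqrt 2 * ((1 + ε₁) * (1 + ε₂)) + 1)).points := by
  set B := MEB (coreset ε₁ p x s) with hB
  set B₁ := MEB (coreset ε₁ p z s) with hB₁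
  set B₂ := MEB (coreset ε₁ p z t) with hB₂
  have hr : B.radius ≤ (1 + ε₂) * B₁.radius := hr
  have h12 : B₁.radius ≤ B₂.radius :=
    MEB_radius_mono (coreset_nonempty hzs) (coreset_mono hzs hst)
  have hB0 : 0 ≤ B.radius := MEB_radius_nonneg _
  have d1 : dist B.center (p j) ≤ Real.sqrt 2 * (1 + ε₁) * B.radius :=
    mem_expand_MEB_coreset hε hxj (by omega)
  -- Every point of `S[z,s]` was also seen by the instance of `x`, so the expanded ball of `S[x,s]`
  -- encloses `S[z,s]` and hence contains its MEB center.
  have d2 : dist B₁.center B.center ≤ Real.sqrt 2 * (1 + ε₁) * B.radius := by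
    refine MEB_dist_center_le (B := B.expand (Real.sqrt 2 * (1 + ε₁))) (coreset_nonempty hzs)
      (by simp only [Ball.expand]; positivity) fun q hq => ?_
    obtain ⟨k, hk, hks, rfl⟩ := exists_of_mem_coreset hzs hq
    exact mem_expand_MEB_coreset hε (by omega) hks
  have d3 : dist B₁.center B₂.center ≤ B₂.radius :=
    MEB_dist_center_le (coreset_nonempty hzs) (MEB_radius_nonneg _) fun q hq =>
      (isMEB_MEB _ (coreset_nonempty (hzs.trans hst))).1 q (coreset_mono hzs hst hq)
  have hrad : Real.sqrt 2 * (1 + ε₁) * B.radius ≤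
      Real.sqrt 2 * (1 + ε₁) * ((1 + ε₂) * B₂.radius) := by
    have : (1 + ε₂) * B₁.radius ≤ (1 + ε₂) * B₂.radius := by gcongr
    have := hr.trans this
    gcongr
  change dist B₂.center (p j) ≤ (2 * Real.sqrt 2 * ((1 + ε₁) * (1 + ε₂)) + 1) * B₂.radius
  have t1 := dist_triangle_left B₂.center (p j) B₁.center
  have t2 := dist_triangle B₁.center B.center (p j)
  linarith

end Coresets

/-! ### Invariant of the kept indices -/

section Runs

/-- The relation between neighboring indices `x`, `z` that are kept at time `t`: either they are
consecutive, or at some earlier time the radii of their instances were close. -/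
def Linked (ε₂ : ℝ) (r : ℕ → ℕ → ℝ) (t x z : ℕ) : Prop :=
  z = x + 1 ∨ ∃ s, z ≤ s ∧ s ≤ t ∧ r x s ≤ (1 + ε₂) * r z s

/-- The invariant of the sequence of indices kept at time `t`. -/
structure Invariant (ε₂ : ℝ) (N : ℕ) (r : ℕ → ℕ → ℝ) (t : ℕ) (X : List ℕ) : Prop where
  getLast : X.getLast? = some t
  head : ∀ x ∈ X.head?, x = 1 ∨ Expired N t x
  lt : X.IsChain (· < ·)
  linked : X.IsChain (Linked ε₂ r t)

variable {ε₂ : ℝ} {N : ℕ} {r : ℕ → ℕ → ℝ} {t : ℕ} {X Y : List ℕ}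

theorem Invariant.le (h : Invariant ε₂ N r t X) {x : ℕ} (hx : x ∈ X) : x ≤ t := by
  obtain ⟨l, rfl⟩ := List.getLast?_eq_some_iff.1 h.getLast
  have hp := (List.isChain_iff_pairwise.1 h.lt)
  rw [List.pairwise_append] at hp
  rcases List.mem_append.1 hx with hx | hx
  · exact (hp.2.2 x hx t (by simp)).le
  · exact (List.mem_singleton.1 hx).le

/-- The deletion condition itself links the new neighbors, with the current time as `s`. Neither end
of the list is ever deleted. -/
theorem Invariant.pruneStep (h : Invariant ε₂ N r t X) (hXY : PruneStep ε₂ (fun x => r x t) X Y) :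
    Invariant ε₂ N r t Y := by
  obtain ⟨l, l', x, y, z, hr⟩ := hXY
  have hz : z ≤ t := h.le (by simp)
  obtain ⟨h1, h2, h3, h4⟩ := h
  have hp := List.isChain_iff_pairwise.1 h3
  refine ⟨?_, ?_, ?_, ?_⟩
  · simpa [List.getLast?_append, List.getLast?_cons_cons] using h1
  · cases l <;> simpa using h2
  · refine List.isChain_iff_pairwise.2 (hp.sublist ?_)
    exact List.Sublist.append_left (List.Sublist.cons_cons _ (List.sublist_cons_self _ _)) _
  · rw [List.isChain_append] at h4 ⊢
    simp only [List.isChain_cons_cons] at h4 ⊢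
    exact ⟨h4.1, ⟨.inr ⟨t, hz, le_rfl, hr⟩, h4.2.1.2.2⟩, by simpa using h4.2.2⟩

theorem Invariant.prunes (h : Invariant ε₂ N r t X) (hXY : Prunes ε₂ (fun x => r x t) X Y) :
    Invariant ε₂ N r t Y := by
  obtain ⟨hXY, -⟩ := hXY
  induction hXY with
  | refl => exact h
  | tail _ hs ih => exact ih.pruneStep hs

theorem Invariant.dropExpired (h : Invariant ε₂ N r t X) :
    Invariant ε₂ N r t (dropExpired N t X) := by
  induction X with
  | nil => exact h
  | cons x X ih =>
    cases X with
    | nil => exact h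
    | cons y l =>
      rw [SlidingMEB.dropExpired]
      split_ifs with hy
      · obtain ⟨h1, h2, h3, h4⟩ := h
        refine ih ⟨by rwa [List.getLast?_cons_cons] at h1, ?_, h3.of_cons, h4.of_cons⟩
        intro z hz
        obtain rfl : y = z := by simpa using hz
        exact .inr hy
      · exact h

/-- The last kept index is `t`, so the new one is consecutive to it; expiry and old links persist.
-/
theorem Invariant.append (h : Invariant ε₂ N r t X) :
    Invariant ε₂ N r (t + 1) (X ++ [t + 1]) := by
  obtain ⟨h1, h2, h3, h4⟩ := h
  refine ⟨by simp, ?_, ?_, ?_⟩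
  · cases X with
    | nil => simp at h1
    | cons x l =>
      intro y hy
      refine (h2 y (by simpa using hy)).imp_right fun he => ?_
      unfold Expired at he ⊢
      omega
  · rw [List.isChain_append]
    exact ⟨h3, .singleton _, by simp [h1]⟩
  · rw [List.isChain_append]
    refine ⟨h4.imp ?_, .singleton _, by simp [h1, Linked]⟩
    rintro a b (hab | ⟨s, hs⟩)
    · exact .inl hab
    · exact .inr ⟨s, hs.1, by omega, hs.2.2⟩

theorem IsRun.invariant {m : ℕ} {ε₁ : ℝ} {p : ℕ → Pt m} {X : ℕ → List ℕ}
    (hX : IsRun ε₁ ε₂ N p X) (t : ℕ) :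
    Invariant ε₂ N (coresetRadius ε₁ p) (t + 1) (X (t + 1)) := by
  refine Invariant.prunes (Invariant.dropExpired ?_) (hX.2 t)
  induction t with
  | zero => rw [hX.1]; exact ⟨rfl, by simp, .singleton _, .singleton _⟩
  | succ t ih => exact ((Invariant.dropExpired ih).prunes (hX.2 t)).append

end Runs

/-- Since `ε ≤ √ε` on `(0,1)`, the linear error `4√2(ε₁+ε₂)` is absorbed by the constant 8. -/
theorem expansion_le {ε₁ ε₂ : ℝ} (h₁ : ε₁ ∈ Set.Ioo (0 : ℝ) 1) (h₂ : ε₂ ∈ Set.Ioo (0 : ℝ) 1) :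
    2 * Real.sqrt 2 * ((1 + ε₁) * (1 + ε₂)) + 1 ≤
      4 * Real.sqrt 2 + 4 + 8 * (Real.sqrt ε₁ + Real.sqrt ε₂) := by
  have hs : Real.sqrt 2 ≤ 2 := Real.sqrt_le_iff.2 (by norm_num)
  have hle : ∀ ε ∈ Set.Ioo (0 : ℝ) 1, ε ≤ Real.sqrt ε := fun ε h =>
    Real.le_sqrt_of_sq_le (by nlinarith [h.1, h.2])
  have e : (1 + ε₁) * (1 + ε₂) ≤ 1 + 2 * (ε₁ + ε₂) := by
    nlinarith [mul_le_mul_of_nonneg_left h₂.2.le h₁.1.le, h₂.1]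
  have := mul_le_mul_of_nonneg_left e (by positivity : 0 ≤ 2 * Real.sqrt 2)
  have := mul_le_mul_of_nonneg_right hs (by linarith [h₁.1, h₂.1] : 0 ≤ ε₁ + ε₂)
  linarith [hle ε₁ h₁, hle ε₂ h₂, Real.sqrt_nonneg 2]

end SlidingMEB

theorem mainTheorem1 :
    ∃ C : ℝ, 0 < C ∧
      ∀ (m N : ℕ) (_hN : 1 ≤ N) (ε₁ ε₂ : ℝ) (_hε₁ : ε₁ ∈ Set.Ioo (0 : ℝ) 1)
        (_hε₂ : ε₂ ∈ Set.Ioo (0 : ℝ) 1)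
        (p : ℕ → SlidingMEB.Pt m) (X : ℕ → List ℕ) (_hX : SlidingMEB.IsRun ε₁ ε₂ N p X)
        (t : ℕ) (_ht : 1 ≤ t),
        ∀ q ∈ SlidingMEB.window p N t,
          q ∈ ((SlidingMEB.MEB (SlidingMEB.returned ε₁ N p t (X t))).expand
            (4 * Real.sqrt 2 + 4 + C * (Real.sqrt ε₁ + Real.sqrt ε₂))).points := by
  refine ⟨8, by norm_num, fun m N hN ε₁ ε₂ h₁ h₂ p X hX t ht q hq => ?_⟩
  obtain ⟨t, rfl⟩ := Nat.exists_eq_add_one_of_ne_zero (by omega : t ≠ 0)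
  have inv := hX.invariant t
  obtain ⟨j, hj, rfl⟩ := Finset.mem_image.1 hq
  rw [Finset.mem_Icc, max_le_iff] at hj
  obtain ⟨⟨hj1, hjN⟩, hjt⟩ := hj
  have hbound := SlidingMEB.expansion_le h₁ h₂
  have hcover : ∀ x ≤ j, p j ∈ ((SlidingMEB.MEB (SlidingMEB.coreset ε₁ p x (t + 1))).expand
      (4 * Real.sqrt 2 + 4 + 8 * (Real.sqrt ε₁ + Real.sqrt ε₂))).points := fun x hx => by
    refine SlidingMEB.mem_expand_mono (le_trans ?_ hbound)
      (SlidingMEB.mem_expand_MEB_coreset h₁.1.le hx hjt)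
    have h0 : 0 ≤ Real.sqrt 2 * (1 + ε₁) := mul_nonneg (Real.sqrt_nonneg 2) (by linarith [h₁.1])
    have := mul_nonneg h0 h₂.1.le
    linarith
  have hfirst : ∀ x ∈ (X (t + 1)).head?, ¬ SlidingMEB.Expired N (t + 1) x → x ≤ j := by
    intro x hx he
    have := (inv.head x hx).resolve_right he
    omega
  match hL : X (t + 1) with
  | [] => simpa [hL] using inv.getLast
  | [x] =>
    have hx : x = t + 1 := by simpa [hL] using inv.getLast
    -- `N ≥ 1` keeps the newest index live, so the default `∅` is not returned.
    have he : ¬ SlidingMEB.Expired N (t + 1) x := by unfold SlidingMEB.Expired; omega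
    rw [SlidingMEB.returned, if_neg he]
    exact hcover x (hfirst x (by simp [hL]) he)
  | x :: z :: l =>
    rw [SlidingMEB.returned]
    split_ifs with he
    -- Whether `z` itself has expired is irrelevant.
    · rcases le_or_gt z j with hzj | hjz
      · exact hcover z hzj
      · have hxj : x < j := by unfold SlidingMEB.Expired at he; omega
        have hlink := inv.linked
        rw [hL, List.isChain_cons_cons] at hlink
        rcases hlink.1 with hz | ⟨s, hzs, hst, hr⟩
        · omega
        · exact SlidingMEB.mem_expand_mono hbound
            (SlidingMEB.mem_expand_MEB_coreset_of_radius_le h₁.1.le h₂.1.le hxj.le hjz.le hzs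
              hst hr)
    · exact hcover x (hfirst x (by simp [hL]) he)
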